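/- Let $(M,\mathsf d)$ be a complete separable metric space with a $\sigma$-finite Borel measure $\mathfrak m$, let $\mathsf G$ be a compact topological group (for instance a compact Lie group) acting continuously on $M$ by isometries which preserve $\mathfrak m$, and let $p\in[1,\infty)$. Let $\mathsf p:M\to M^*=M/\mathsf G$, $x\mapsto x^*$, be the projection onto the orbit space, equipped with the metric $\mathsf d^*(x^*,y^*)=\inf_{g\in \mathsf G}\mathsf d(gx,y)$ and the measure $\mathfrak m^*=\mathsf p_\sharp\mathfrak m$. Let $\mathcal P$ denote Borel probability measures, $\mathcal P_p$ those with finite $p$-th moment, $\mathcal P^{ac}$ those absolutely continuous with respect to the reference measure, and $\mathcal P^{\mathsf G}(M)$ the $\mathsf G$-invariant ones. Let $\nu_{\mathsf G}$ be the Haar probability measure of $\mathsf G$, $\nu_x=(g\mapsto gx)_\sharp\nu_{\mathsf G}$ (which depends only on $x^*$), and, for $\mu\in\mathcal P(M^*)$, $$\Lambda(\mu)=\hat\mu=\int_{M^*}\nu_x\,d\mu(x^*)\in\mathcal P(M).$$ 1. For every $\mu\in\mathcal P(M^*)$, $\hat\mu$ is the unique $\mathsf G$-invariant probability measure on $M$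 with $\mathsf p_\sharp\hat\mu=\mu$. 2. $\Lambda(\mathcal P^{ac}(M^*))=\mathcal P^{ac}(M)\cap\mathcal P^{\mathsf G}(M)$. 3. $\Lambda(\mathcal P_p(M^*))=\mathcal P_p(M)\cap\mathcal P^{\mathsf G}(M)$. 4. $\Lambda$ is injective, and $W_p(\hat\mu_0,\hat\mu_1)=W_p(\mu_0,\mu_1)$ for all $\mu_0,\mu_1\in\mathcal P_p(M^*)$. In particular, if $(\mu_t)_{t\in[0,1]}$ is a $W_p$-geodesic in $\mathcal P_p(M^*)$, then $(\hat\mu_t)_{t\in[0,1]}$ is a $W_p$-geodesic in $\mathcal P_p(M)$ consisting of $\mathsf G$-invariant measures. 5. There is a Borel measurable map $s=(\bar x,\bar y):M^*\times M^*\to M\times M$ such that $\mathsf p(\bar x(a,b))=a$, $\mathsf p(\bar y(a,b))=b$ and $\mathsf d(\bar x(a,b),\bar y(a,b))=\mathsf d^*(a,b)$ for all $a,b\in M^*$. For every such $s$, all $\mu_0,\mu_1\in\mathcal P_p(M^*)$ and every $p$-optimal coupling $\pi$ of $(\mu_0,\mu_1)$, the lift $$\hat\pi=\int_{M^*\times M^*}\big(g\mapsto(g\bar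 x(a,b),g\bar y(a,b))\big)_\sharp\nu_{\mathsf G}\;d\pi(a,b)$$ is a $p$-optimal coupling of $(\hat\mu_0,\hat\mu_1)$, and $\mathsf d(x,y)=\mathsf d^*(x^*,y^*)$ for $\hat\pi$-almost every $(x,y)$. 6. In the situation of 5, if $(\phi,\psi)$ is a $p$-dual solution corresponding to $\pi$, then $(\hat\phi,\hat\psi)$, where $\hat\phi(x)=\phi(x^*)$ and $\hat\psi(y)=\psi(y^*)$, is a $p$-dual solution corresponding to $\hat\pi$. Here a $p$-dual solution corresponding to a coupling $\pi$ of $(\mu_0,\mu_1)$ is a pair of functions with values in $\mathbb R\cup\{-\infty\}$, $\phi\in L^1(\mu_0)$, $\psi\in L^1(\mu_1)$, with $\phi(x)+\psi(y)\le \mathsf d(x,y)^p$ everywhere, which maximizes $\int\phi\,d\mu_0+\int\psi\,d\mu_1$ among all such pairs, and with $\phi(x)+\psi(y)=\mathsf d(x,y)^p$ for $\pi$-almost every $(x,y)$ (with $\mathsf d^*$ in place of $\mathsf d$ on $M^*$). 7. If $\phi:M^*\to\mathbb R\cup\{-\infty\}$ is $c_p$-concave, that is $\phi=\eta^{c_p}$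 for some $\eta:M^*\to\mathbb R\cup\{-\infty\}$, where $\eta^{c_p}(a)=\inf_{b}(\mathsf d^*(a,b)^p-\eta(b))$, then $\hat\phi$ is $c_p$-concave on $M$ and $\hat\phi^{\,c_p}=\widehat{\phi^{c_p}}$. Hence dual solutions of the form $(\phi,\phi^{c_p})$ with $\phi$ $c_p$-concave lift to dual solutions of the same form. -/

import Mathlib

open MeasureTheory Set
open scoped ENNReal

noncomputable section

/-! ### Optimal transport on a metric space -/

section Transport

variable {X : Type*} [MetricSpace X] [MeasurableSpace X]

/-- Finite `p`-th moment: `∫ d(x, x₀) ^ p dμ(x) < ∞` for some `x₀`. -/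
def HasFiniteMoment (p : ℝ) (μ : Measure X) : Prop :=
  ∃ x₀ : X, ∫⁻ x, edist x x₀ ^ p ∂μ < ∞

/-- `π` has first marginal `μ` and second marginal `ν`. -/
def IsCoupling (π : Measure (X × X)) (μ ν : Measure X) : Prop :=
  π.map Prod.fst = μ ∧ π.map Prod.snd = ν

/-- The transport cost `∫ d(x, y) ^ p dπ(x, y)`. -/
def transportCost (p : ℝ) (π : Measure (X × X)) : ℝ≥0∞ :=
  ∫⁻ z, edist z.1 z.2 ^ p ∂π

/-- The Wasserstein distance `W_p`, with values in `[0, ∞]`. -/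
def wassersteinDist (p : ℝ) (μ ν : Measure X) : ℝ≥0∞ :=
  (⨅ (π : Measure (X × X)) (_ : IsCoupling π μ ν), transportCost p π) ^ (1 / p)

/-- `π` is a `p`-optimal coupling of `μ` and `ν`. -/
def IsOptimalCoupling (p : ℝ) (π : Measure (X × X)) (μ ν : Measure X) : Prop :=
  IsCoupling π μ ν ∧
    ∀ π' : Measure (X × X), IsCoupling π' μ ν → transportCost p π ≤ transportCost p π'

/-- `γ : [0, 1] → 𝒫_p(X)` is a (minimizing, constant speed) `W_p`-geodesic. -/
def IsWassersteinGeodesic (p : ℝ) (γ : unitInterval → ProbabilityMeasure X) : Prop :=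
  (∀ t, HasFiniteMoment p (γ t : Measure X)) ∧
    ∀ s t : unitInterval, wassersteinDist p (γ s : Measure X) (γ t) =
      ENNReal.ofReal |(s : ℝ) - t| * wassersteinDist p (γ 0 : Measure X) (γ 1)

/-- `φ : X → [-∞, ∞]` is integrable. -/
def ERealIntegrable (φ : X → EReal) (μ : Measure X) : Prop :=
  AEMeasurable φ μ ∧ ∫⁻ x, (φ x).abs ∂μ < ∞

/-- The pair `(φ, ψ)` of functions `X → ℝ ∪ {-∞}` competes in the Kantorovich dual problem
for `μ`, `ν` and the cost `d ^ p`. -/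
structure IsDualAdmissible (p : ℝ) (μ ν : Measure X) (φ ψ : X → EReal) : Prop where
  left_ne_top : ∀ x, φ x ≠ ⊤
  right_ne_top : ∀ y, ψ y ≠ ⊤
  left_integrable : ERealIntegrable φ μ
  right_integrable : ERealIntegrable ψ ν
  add_le : ∀ x y, φ x + ψ y ≤ ((dist x y ^ p : ℝ) : EReal)

/-- The value `∫ φ dμ + ∫ ψ dν` of the Kantorovich dual problem (used for integrable `φ`, `ψ`,
which are finite almost everywhere). -/
def dualValue (μ ν : Measure X) (φ ψ : X → EReal) : ℝ :=
  ∫ x, (φ x).toReal ∂μ + ∫ y, (ψ y).toReal ∂ν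

/-- `(φ, ψ)` is a `p`-dual solution corresponding to the coupling `π` of `μ` and `ν`: it maximizes
the Kantorovich dual problem, and `φ(x) + ψ(y) = d(x, y) ^ p` for `π`-almost every `(x, y)`. -/
structure IsDualSolution (p : ℝ) (π : Measure (X × X)) (μ ν : Measure X)
    (φ ψ : X → EReal) : Prop where
  admissible : IsDualAdmissible p μ ν φ ψ
  maximal : ∀ φ' ψ' : X → EReal, IsDualAdmissible p μ ν φ' ψ' →
    dualValue μ ν φ' ψ' ≤ dualValue μ ν φ ψ
  ae_eq : ∀ᵐ z ∂π, φ z.1 + ψ z.2 = ((dist z.1 z.2 ^ p : ℝ) : EReal)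

end Transport

section Concave

variable {X : Type*} [MetricSpace X]

/-- The `c_p`-transform `ψ^{c_p}(x) = inf_y (d(x, y) ^ p - ψ(y))`. -/
def cTransform (p : ℝ) (ψ : X → EReal) (x : X) : EReal :=
  ⨅ y : X, (((dist x y ^ p : ℝ) : EReal) - ψ y)

/-- `φ : X → ℝ ∪ {-∞}` is `c_p`-concave. -/
def IsCConcave (p : ℝ) (φ : X → EReal) : Prop :=
  (∀ x, φ x ≠ ⊤) ∧ ∃ ψ : X → EReal, (∀ y, ψ y ≠ ⊤) ∧ φ = cTransform p ψ

end Concave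

/-! ### The orbit space -/

/-- The orbit space `M* = M / G`. -/
def OrbitSpace (G M : Type*) [Group G] [MulAction G M] : Type _ :=
  MulAction.orbitRel.Quotient G M

namespace OrbitSpace

section Metric

variable {G M : Type*} [Group G] [MulAction G M]

variable (G) in
/-- The projection `M → M*`. -/
def proj (x : M) : OrbitSpace G M := Quotient.mk (MulAction.orbitRel G M) x

variable (G) in
theorem proj_surjective : Function.Surjective (proj G : M → OrbitSpace G M) :=
  Quotient.mk_surjective

theorem proj_eq_iff {x y : M} : proj G x = proj G y ↔ ∃ g : G, g • y = x :=
  Quotient.eq.trans (MulAction.orbitRel_apply.trans MulAction.mem_orbit_iff)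

variable [MetricSpace M] [IsIsometricSMul G M]

theorem iInf_dist_congr {x y x' y' : M} (hx : ∃ g : G, g • x' = x) (hy : ∃ g : G, g • y' = y) :
    (⨅ g : G, dist (g • x) y) = ⨅ g : G, dist (g • x') y' := by
  obtain ⟨h, rfl⟩ := hx
  obtain ⟨k, rfl⟩ := hy
  refine Equiv.iInf_congr ((Equiv.mulRight h).trans (Equiv.mulLeft k⁻¹)) fun g => ?_
  have : dist ((k⁻¹ * (g * h)) • x') y' = dist (k • ((k⁻¹ * (g * h)) • x')) (k • y') :=
    (dist_smul k _ _).symm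
  simp only [Equiv.trans_apply, Equiv.coe_mulRight, Equiv.coe_mulLeft]
  rw [this, smul_smul, smul_smul]
  simp

/-- The quotient distance `d*(x*, y*) = inf_g d(gx, y)`. -/
def quotDist (a b : OrbitSpace G M) : ℝ :=
  Quotient.liftOn₂ a b (fun x y : M => ⨅ g : G, dist (g • x) y) fun _ _ _ _ h₁ h₂ =>
    iInf_dist_congr (MulAction.mem_orbit_iff.1 h₁) (MulAction.mem_orbit_iff.1 h₂)

theorem quotDist_proj (x y : M) :
    quotDist (proj G x) (proj G y) = ⨅ g : G, dist (g • x) y := rfl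

theorem quotDist_le (g : G) (x y : M) : quotDist (proj G x) (proj G y) ≤ dist (g • x) y :=
  ciInf_le ⟨0, by rintro _ ⟨g, rfl⟩; exact dist_nonneg⟩ g

variable [TopologicalSpace G] [CompactSpace G] [ContinuousSMul G M]

theorem exists_quotDist_eq (x y : M) :
    ∃ g : G, quotDist (proj G x) (proj G y) = dist (g • x) y := by
  have hc : Continuous fun g : G => dist (g • x) y := by fun_prop
  obtain ⟨g, -, hg⟩ := isCompact_univ.exists_isMinOn (univ_nonempty (α := G)) hc.continuousOn
  refine ⟨g, le_antisymm (quotDist_le g x y) (le_ciInf fun k => hg (mem_univ k))⟩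

/-- The orbit space with the metric `d*`. -/
instance : MetricSpace (OrbitSpace G M) where
  dist := quotDist
  dist_self a := by
    obtain ⟨x, rfl⟩ := proj_surjective G a
    refine le_antisymm ?_ (Real.iInf_nonneg fun _ => dist_nonneg)
    simpa using quotDist_le (1 : G) x x
  dist_comm a b := by
    obtain ⟨x, rfl⟩ := proj_surjective G a
    obtain ⟨y, rfl⟩ := proj_surjective G b
    have key : ∀ u v : M, quotDist (proj G u) (proj G v) ≤ quotDist (proj G v) (proj G u) := by
      intro u v
      obtain ⟨g, hg⟩ := exists_quotDist_eq (G := G) v u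
      rw [hg]
      refine (quotDist_le g⁻¹ u v).trans (le_of_eq ?_)
      rw [← dist_smul g, smul_inv_smul, dist_comm]
    exact le_antisymm (key x y) (key y x)
  dist_triangle a b c := by
    obtain ⟨x, rfl⟩ := proj_surjective G a
    obtain ⟨y, rfl⟩ := proj_surjective G b
    obtain ⟨z, rfl⟩ := proj_surjective G c
    obtain ⟨g, hg⟩ := exists_quotDist_eq (G := G) x y
    obtain ⟨h, hh⟩ := exists_quotDist_eq (G := G) y z
    rw [hg, hh]
    refine (quotDist_le (h * g) x z).trans ?_
    have := dist_triangle ((h * g) • x) (h • y) z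
    rw [mul_smul, dist_smul] at this
    rwa [mul_smul]
  eq_of_dist_eq_zero {a b} hab := by
    obtain ⟨x, rfl⟩ := proj_surjective G a
    obtain ⟨y, rfl⟩ := proj_surjective G b
    obtain ⟨g, hg⟩ := exists_quotDist_eq (G := G) x y
    have h0 : dist (g • x) y = 0 := hg.symm.trans hab
    exact (proj_eq_iff.2 ⟨g, dist_eq_zero.1 h0⟩).symm

/-- The Borel `σ`-algebra of `(M*, d*)`. -/
instance : MeasurableSpace (OrbitSpace G M) := borel _

instance : BorelSpace (OrbitSpace G M) := ⟨rfl⟩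

theorem dist_proj (x y : M) : dist (proj G x) (proj G y) = ⨅ g : G, dist (g • x) y := rfl

theorem lipschitzWith_proj : LipschitzWith 1 (proj G : M → OrbitSpace G M) :=
  LipschitzWith.of_dist_le_mul fun x y => by
    have h : dist (proj G x) (proj G y) ≤ dist ((1 : G) • x) y := quotDist_le (1 : G) x y
    simpa using h

instance [SecondCountableTopology M] : SecondCountableTopology (OrbitSpace G M) := by
  have : TopologicalSpace.SeparableSpace (OrbitSpace G M) :=
    (proj_surjective G).denseRange.separableSpace lipschitzWith_proj.continuous
  exact UniformSpace.secondCountable_of_separable _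

variable [MeasurableSpace M] [BorelSpace M]

theorem measurable_proj : Measurable (proj G : M → OrbitSpace G M) :=
  (lipschitzWith_proj (G := G)).continuous.measurable

end Metric

end OrbitSpace

/-! ### Lifts of measures, plans -/

namespace OrbitLift

open OrbitSpace

variable {G M : Type*} [Group G] [TopologicalSpace G] [IsTopologicalGroup G] [CompactSpace G]
  [MeasurableSpace G] [BorelSpace G]

variable (G) in
/-- The Haar probability measure `ν_G` of the compact group `G`. -/
def haarProb : Measure G := Measure.haarMeasure ⊤

instance : (haarProb G).IsHaarMeasure := inferInstanceAs (Measure.haarMeasure ⊤).IsHaarMeasure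

instance : IsProbabilityMeasure (haarProb G) :=
  ⟨Measure.haarMeasure_self (K₀ := (⊤ : TopologicalSpace.PositiveCompacts G))⟩

theorem map_mul_right_haarProb (h : G) : (haarProb G).map (· * h) = haarProb G := by
  have : IsProbabilityMeasure ((haarProb G).map (· * h)) :=
    Measure.isProbabilityMeasure_map (measurable_mul_const h).aemeasurable
  exact Measure.isHaarMeasure_eq_of_isProbabilityMeasure _ _

variable [MetricSpace M] [SecondCountableTopology M] [MeasurableSpace M] [BorelSpace M]
  [MulAction G M] [ContinuousSMul G M]

variable (G) in
/-- The orbit measure `ν_x = (g ↦ g x)_♯ ν_G`. -/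
def orbitMeasure (x : M) : Measure M := (haarProb G).map (fun g => g • x)

set_option linter.unusedSectionVars false in
theorem measurable_orbitMap (x : M) : Measurable fun g : G => g • x :=
  (continuous_id.smul continuous_const).measurable

instance (x : M) : IsProbabilityMeasure (orbitMeasure G x) :=
  Measure.isProbabilityMeasure_map (measurable_orbitMap x).aemeasurable

theorem orbitMeasure_smul (h : G) (x : M) : orbitMeasure G (h • x) = orbitMeasure G x := by
  unfold orbitMeasure
  conv_rhs => rw [← map_mul_right_haarProb h,
    Measure.map_map (measurable_orbitMap x) (measurable_mul_const h)]
  simp only [Function.comp_def, mul_smul]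

theorem measurable_orbitMeasure : Measurable (orbitMeasure G : M → Measure M) := by
  refine Measure.measurable_of_measurable_coe _ fun s hs => ?_
  have hact : Measurable fun q : M × G => q.2 • q.1 :=
    (continuous_snd.smul continuous_fst).measurable
  have := measurable_measure_prodMk_left (ν := haarProb G) (hact hs)
  have heq : (fun x : M => orbitMeasure G x s) =
      fun x => haarProb G (Prod.mk x ⁻¹' ((fun q : M × G => q.2 • q.1) ⁻¹' s)) :=
    funext fun x => Measure.map_apply (measurable_orbitMap x) hs
  rw [heq]
  exact this

/-- The assignment `x* ↦ ν_x`. -/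
def orbitMeasureStar (a : OrbitSpace G M) : Measure M :=
  Quotient.liftOn a (orbitMeasure G) fun x y hxy => by
    obtain ⟨g, rfl⟩ := MulAction.mem_orbit_iff.1 hxy
    exact orbitMeasure_smul g y

theorem orbitMeasureStar_proj (x : M) : orbitMeasureStar (proj G x) = orbitMeasure G x := rfl

instance (a : OrbitSpace G M) : IsProbabilityMeasure (orbitMeasureStar a) := by
  obtain ⟨x, rfl⟩ := proj_surjective G a
  rw [orbitMeasureStar_proj]
  infer_instance

variable [IsIsometricSMul G M]

theorem measurable_orbitMeasureStar [CompleteSpace M] :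
    Measurable (orbitMeasureStar : OrbitSpace G M → Measure M) := by
  refine Measure.measurable_of_measurable_coe _ fun s hs => ?_
  rw [← measurable_proj.measurable_comp_iff_of_surjective (proj_surjective G)]
  exact (Measure.measurable_coe hs).comp measurable_orbitMeasure

/-- The lift `Λ(μ) = ∫ ν_x dμ(x*)` of a probability measure on `M*`. -/
def liftMeasure [CompleteSpace M] (μ : ProbabilityMeasure (OrbitSpace G M)) :
    ProbabilityMeasure M :=
  ⟨(μ : Measure (OrbitSpace G M)).bind orbitMeasureStar, by
    constructor
    rw [Measure.bind_apply MeasurableSet.univ measurable_orbitMeasureStar.aemeasurable]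
    simp⟩

variable (G) in
/-- For `(x, y) ∈ M × M` the image `π_{x,y}` of the Haar probability measure under
`g ↦ (gx, gy)`. -/
def orbitPlan (x y : M) : Measure (M × M) := (haarProb G).map (fun g => (g • x, g • y))

/-- `s` is a (Borel) measurable choice of representatives of pairs of orbits which realize the
distance between these orbits. -/
structure IsOptimalSection (s : OrbitSpace G M × OrbitSpace G M → M × M) : Prop where
  measurable : Measurable s
  proj_fst : ∀ z, proj G (s z).1 = z.1
  proj_snd : ∀ z, proj G (s z).2 = z.2
  dist_eq : ∀ z, dist (s z).1 (s z).2 = dist z.1 z.2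

/-- The lift `π̂ = ∫ π_{s(x*, y*)} dπ(x*, y*)` of a plan on `M* × M*`, for a choice `s` of
representatives. -/
def liftPlan (s : OrbitSpace G M × OrbitSpace G M → M × M)
    (π : Measure (OrbitSpace G M × OrbitSpace G M)) : Measure (M × M) :=
  π.bind fun z => orbitPlan G (s z).1 (s z).2

/-- The lift of a function on `M*`. -/
def liftFun {β : Type*} (φ : OrbitSpace G M → β) (x : M) : β := φ (proj G x)

end OrbitLift

end

set_option linter.unusedSectionVars false

noncomputable section

section Selection

open Filter Topology TopologicalSpace

variable {X Y : Type*} [MetricSpace X] [CompleteSpace X] [SecondCountableTopology X]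
  [MeasurableSpace X] [BorelSpace X] [MeasurableSpace Y]

/-- The **Kuratowski–Ryll-Nardzewski selection theorem**: a weakly measurable multifunction with
nonempty closed values in a Polish space has a measurable selection. -/
theorem exists_measurable_selection (F : Y → Set X) (hne : ∀ y, (F y).Nonempty)
    (hcl : ∀ y, IsClosed (F y))
    (hF : ∀ (x : X) (r : ℝ), MeasurableSet {y | (F y ∩ Metric.ball x r).Nonempty}) :
    ∃ s : Y → X, Measurable s ∧ ∀ y, s y ∈ F y := by
  classical
  rcases isEmpty_or_nonempty Y with hY | ⟨⟨y₀⟩⟩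
  · exact ⟨fun y => (hY.false y).elim, measurable_of_empty _, fun y => (hY.false y).elim⟩
  have : Nonempty X := ⟨(hne y₀).some⟩
  let u : ℕ → X := denseSeq X
  have hu : ∀ (x : X) (r : ℝ), 0 < r → ∃ k, dist x (u k) < r := fun x r hr =>
    (denseRange_denseSeq X).exists_dist_lt x hr
  let Q : ℕ → Y → ℕ → Prop := fun n y k => (F y ∩ Metric.ball (u k) ((1 / 2 : ℝ) ^ n)).Nonempty
  have hQm : ∀ n k, MeasurableSet {y | Q n y k} := fun n k => hF _ _
  have hpos : ∀ n : ℕ, (0 : ℝ) < (1 / 2 : ℝ) ^ n := fun n => by positivity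
  have step : ∀ n (k : Y → ℕ), Measurable k → (∀ y, Q n y (k y)) →
      ∃ l : Y → ℕ, Measurable l ∧ (∀ y, Q (n + 1) y (l y)) ∧
        ∀ y, dist (u (k y)) (u (l y)) < 2 * (1 / 2 : ℝ) ^ n := by
    intro n k hk hkQ
    have hex : ∀ y, ∃ j, Q (n + 1) y j ∧ dist (u (k y)) (u j) < 2 * (1 / 2 : ℝ) ^ n := by
      intro y
      obtain ⟨x, hxF, hx⟩ := hkQ y
      obtain ⟨j, hj⟩ := hu x _ (hpos (n + 1))
      refine ⟨j, ⟨x, hxF, hj⟩, ?_⟩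
      have h1 := dist_triangle_left (u (k y)) (u j) x
      have h2 : dist x (u (k y)) < (1 / 2 : ℝ) ^ n := hx
      have h3 : (1 / 2 : ℝ) ^ (n + 1) ≤ (1 / 2 : ℝ) ^ n := by
        rw [pow_succ]; linarith [hpos n]
      linarith
    refine ⟨fun y => Nat.find (hex y), measurable_find hex fun j => ?_,
      fun y => (Nat.find_spec (hex y)).1, fun y => (Nat.find_spec (hex y)).2⟩
    have : MeasurableSet {y | dist (u (k y)) (u j) < 2 * (1 / 2 : ℝ) ^ n} :=
      hk (MeasurableSet.of_discrete (s := {i | dist (u i) (u j) < 2 * (1 / 2 : ℝ) ^ n}))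
    exact (hQm (n + 1) j).inter this
  have base : ∃ l : Y → ℕ, Measurable l ∧ ∀ y, Q 0 y (l y) := by
    have hex : ∀ y, ∃ j, Q 0 y j := fun y => by
      obtain ⟨x, hxF⟩ := hne y
      obtain ⟨j, hj⟩ := hu x _ (hpos 0)
      exact ⟨j, x, hxF, hj⟩
    exact ⟨fun y => Nat.find (hex y), measurable_find hex (hQm 0), fun y => Nat.find_spec (hex y)⟩
  choose next hnext_meas hnextQ hnext_dist using step
  obtain ⟨l₀, hl₀, hl₀Q⟩ := base
  let k : (n : ℕ) → {l : Y → ℕ // Measurable l ∧ ∀ y, Q n y (l y)} := fun n =>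
    Nat.rec ⟨l₀, hl₀, hl₀Q⟩ (fun n l => ⟨next n l.1 l.2.1 l.2.2, hnext_meas _ _ _ _,
      hnextQ _ _ _ _⟩) n
  have hk_dist : ∀ y n, dist (u ((k n).1 y)) (u ((k (n + 1)).1 y)) ≤ 2 * (1 / 2 : ℝ) ^ n :=
    fun y n => (hnext_dist n (k n).1 (k n).2.1 (k n).2.2 y).le
  have hcauchy : ∀ y, CauchySeq fun n => u ((k n).1 y) := fun y =>
    cauchySeq_of_le_geometric (1 / 2 : ℝ) 2 (by norm_num) (hk_dist y)
  choose s hs using fun y => cauchySeq_tendsto_of_complete (hcauchy y)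
  refine ⟨s, measurable_of_tendsto_metrizable (fun n => ?_) (tendsto_pi_nhds.2 hs), fun y => ?_⟩
  · exact (measurable_from_nat (f := u)).comp (k n).2.1
  · choose x hxF hx using fun n => (k n).2.2 y
    refine (hcl y).mem_of_tendsto (f := x) (b := atTop) ?_ (Eventually.of_forall hxF)
    have h0 : Tendsto (fun n => dist (u ((k n).1 y)) (x n)) atTop (𝓝 0) :=
      squeeze_zero (fun _ => dist_nonneg) (fun n => (dist_comm _ _).trans_le (hx n).le)
        (tendsto_pow_atTop_nhds_zero_of_lt_one (by norm_num) (by norm_num))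
    exact (tendsto_iff_of_dist h0).1 (hs y)

/-- A continuous closed map on a closed subset of a Polish space has a measurable section. -/
theorem exists_measurable_section_of_isClosedMap {Z : Type*} [MetricSpace Z] [MeasurableSpace Z]
    [OpensMeasurableSpace Z] {q : X → Z} (hq : Continuous q) (hq' : IsClosedMap q)
    {K : Set X} (hK : IsClosed K) (hsurj : ∀ z, ∃ x ∈ K, q x = z) :
    ∃ s : Z → X, Measurable s ∧ ∀ z, s z ∈ K ∧ q (s z) = z := by
  refine exists_measurable_selection (fun z => K ∩ q ⁻¹' {z}) hsurj
    (fun z => hK.inter (isClosed_singleton.preimage hq)) fun x r => ?_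
  obtain ⟨v, -, hv, hv'⟩ := exists_seq_strictMono_tendsto r
  have : {z | ((K ∩ q ⁻¹' {z}) ∩ Metric.ball x r).Nonempty} =
      ⋃ n, q '' (K ∩ Metric.closedBall x (v n)) := by
    ext z
    simp only [mem_ofPred_eq, mem_iUnion, mem_image]
    constructor
    · rintro ⟨w, ⟨hwK, hwz⟩, hw⟩
      obtain ⟨n, hn⟩ := (hv'.eventually (lt_mem_nhds (Metric.mem_ball.1 hw))).exists
      exact ⟨n, w, ⟨hwK, hn.le⟩, hwz⟩
    · rintro ⟨n, w, ⟨hwK, hw⟩, hwz⟩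
      exact ⟨w, ⟨hwK, hwz⟩, (Metric.mem_closedBall.1 hw).trans_lt (hv n)⟩
  rw [this]
  exact MeasurableSet.iUnion fun n =>
    (hq' _ (hK.inter Metric.isClosed_closedBall)).measurableSet

end Selection

namespace OrbitSpace

theorem proj_smul {G M : Type*} [Group G] [MulAction G M] (g : G) (x : M) :
    proj G (g • x) = proj G x :=
  proj_eq_iff.2 ⟨g, rfl⟩

variable {G M : Type*} [Group G] [TopologicalSpace G] [CompactSpace G] [MetricSpace M]
  [MulAction G M] [ContinuousSMul G M] [IsIsometricSMul G M]

theorem dist_proj_le (x y : M) : dist (proj G x) (proj G y) ≤ dist x y := by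
  simpa using (lipschitzWith_proj (G := G)).dist_le_mul x y

theorem exists_dist_proj_eq (x y : M) : ∃ g : G, dist (g • x) y = dist (proj G x) (proj G y) := by
  obtain ⟨g, hg⟩ := exists_quotDist_eq (G := G) x y
  exact ⟨g, hg.symm⟩

theorem edist_proj_le (x y : M) : edist (proj G x) (proj G y) ≤ edist x y := by
  simpa using (lipschitzWith_proj (G := G)).edist_le_mul x y

theorem edist_le_add_diam_orbit (x y : M) :
    edist x y ≤ edist (proj G x) (proj G y) + Metric.ediam (range fun g : G => g • y) := by
  obtain ⟨g, hg⟩ := exists_dist_proj_eq (G := G) x y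
  have h : edist x (g⁻¹ • y) = edist (proj G x) (proj G y) := by
    rw [edist_dist, edist_dist, ← hg, ← dist_smul g x, smul_inv_smul]
  refine (edist_triangle x (g⁻¹ • y) y).trans ?_
  rw [h]
  gcongr
  exact Metric.edist_le_ediam_of_mem ⟨g⁻¹, rfl⟩ ⟨1, one_smul G y⟩

theorem ediam_orbit_lt_top (y : M) : Metric.ediam (range fun g : G => g • y) < ∞ :=
  by
  have hc : Continuous fun g : G => g • y := by fun_prop
  exact (Metric.isBounded_iff_ediam_ne_top.1 (isCompact_range hc).isBounded).lt_top

theorem isOpenMap_proj : IsOpenMap (proj G : M → OrbitSpace G M) := by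
  intro U hU
  rw [Metric.isOpen_iff]
  rintro _ ⟨x, hx, rfl⟩
  obtain ⟨r, hr, hrU⟩ := Metric.isOpen_iff.1 hU x hx
  refine ⟨r, hr, fun b hb => ?_⟩
  obtain ⟨y, rfl⟩ := proj_surjective G b
  obtain ⟨g, hg⟩ := exists_dist_proj_eq (G := G) y x
  exact ⟨g • y, hrU (hg.trans_lt hb), proj_smul g y⟩

theorem isOpenQuotientMap_proj : IsOpenQuotientMap (proj G : M → OrbitSpace G M) :=
  ⟨proj_surjective G, lipschitzWith_proj.continuous, isOpenMap_proj⟩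

theorem isClosedMap_prodMap_proj :
    IsClosedMap (Prod.map (proj G : M → OrbitSpace G M) (proj G : M → OrbitSpace G M)) := by
  intro F hF
  rw [← (isOpenQuotientMap_proj.prodMap isOpenQuotientMap_proj).isQuotientMap.isClosed_preimage]
  have : Prod.map (proj G : M → OrbitSpace G M) (proj G : M → OrbitSpace G M) ⁻¹'
      (Prod.map (proj G) (proj G) '' F) =
      Prod.snd '' {q : (G × G) × M × M | (q.1.1 • q.2.1, q.1.2 • q.2.2) ∈ F} := by
    ext ⟨x, y⟩
    constructor
    · rintro ⟨⟨x', y'⟩, hF', h⟩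
      obtain ⟨h₁, h₂⟩ := Prod.mk.inj h
      obtain ⟨g, rfl⟩ := proj_eq_iff.1 h₁
      obtain ⟨k, rfl⟩ := proj_eq_iff.1 h₂
      exact ⟨((g, k), x, y), hF', rfl⟩
    · rintro ⟨⟨⟨g, k⟩, x', y'⟩, hF', h⟩
      obtain ⟨rfl, rfl⟩ := Prod.mk.inj h
      exact ⟨_, hF', Prod.ext (proj_smul g _) (proj_smul k _)⟩
  rw [this]
  exact isClosedMap_snd_of_compactSpace _ (hF.preimage (by fun_prop))

end OrbitSpace

namespace OrbitLift

open OrbitSpace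

theorem exists_isOptimalSection {G M : Type*} [Group G] [TopologicalSpace G] [CompactSpace G]
    [MetricSpace M] [CompleteSpace M] [SecondCountableTopology M] [MeasurableSpace M]
    [BorelSpace M] [MulAction G M] [ContinuousSMul G M] [IsIsometricSMul G M] :
    ∃ s : OrbitSpace G M × OrbitSpace G M → M × M, IsOptimalSection s := by
  have hc : Continuous (proj G : M → OrbitSpace G M) := lipschitzWith_proj.continuous
  have hK : IsClosed {w : M × M | dist w.1 w.2 = dist (proj G w.1) (proj G w.2)} :=
    isClosed_eq (by fun_prop) (by fun_prop)
  obtain ⟨s, hs, hs'⟩ := exists_measurable_section_of_isClosedMap (hc.prodMap hc)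
    isClosedMap_prodMap_proj hK fun ⟨a, b⟩ => by
      obtain ⟨x, rfl⟩ := proj_surjective G a
      obtain ⟨y, rfl⟩ := proj_surjective G b
      obtain ⟨g, hg⟩ := exists_dist_proj_eq (G := G) x y
      exact ⟨(g • x, y), by simpa [proj_smul] using hg, Prod.ext (proj_smul g x) rfl⟩
  refine ⟨s, hs, fun z => congrArg Prod.fst (hs' z).2, fun z => congrArg Prod.snd (hs' z).2,
    fun z => (hs' z).1.trans ?_⟩
  rw [show proj G (s z).1 = z.1 from congrArg Prod.fst (hs' z).2,
    show proj G (s z).2 = z.2 from congrArg Prod.snd (hs' z).2]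

section Orbit

variable {G M : Type*} [Group G] [TopologicalSpace G] [IsTopologicalGroup G] [CompactSpace G]
  [MeasurableSpace G] [BorelSpace G]
  [MetricSpace M] [SecondCountableTopology M] [MeasurableSpace M] [BorelSpace M]
  [MulAction G M] [ContinuousSMul G M]

theorem orbitMeasure_preimage_smul (h : G) (x : M) {A : Set M} (hA : MeasurableSet A) :
    orbitMeasure G x ((h • ·) ⁻¹' A) = orbitMeasure G x A := by
  have hh : Measurable fun y : M => h • y := (continuous_const_smul h).measurable
  rw [orbitMeasure, Measure.map_apply (measurable_orbitMap x) (hh hA),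
    Measure.map_apply (measurable_orbitMap x) hA,
    ← measure_preimage_mul (haarProb G) h ((fun g : G => g • x) ⁻¹' A)]
  simp only [preimage_preimage, mul_smul]

theorem lintegral_orbitMeasure_apply (m : Measure M) [SFinite m] [SMulInvariantMeasure G M m]
    {A : Set M} (hA : MeasurableSet A) : ∫⁻ x, orbitMeasure G x A ∂m = m A := by
  have hact : Measurable fun q : M × G => q.2 • q.1 :=
    (continuous_snd.smul continuous_fst).measurable
  calc ∫⁻ x, orbitMeasure G x A ∂m
      = (m.prod (haarProb G)) ((fun q : M × G => q.2 • q.1) ⁻¹' A) := by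
        rw [Measure.prod_apply (hact hA)]
        exact lintegral_congr fun x => Measure.map_apply (measurable_orbitMap x) hA
    _ = ∫⁻ g, m ((g • ·) ⁻¹' A) ∂(haarProb G) := Measure.prod_apply_symm (hact hA)
    _ = m A := by simp

variable [IsIsometricSMul G M]

theorem map_proj_orbitMeasureStar (a : OrbitSpace G M) :
    (orbitMeasureStar a).map (proj G) = Measure.dirac a := by
  obtain ⟨x, rfl⟩ := proj_surjective G a
  rw [orbitMeasureStar_proj, orbitMeasure, Measure.map_map measurable_proj (measurable_orbitMap x)]
  have : (proj G ∘ fun g : G => g • x) = fun _ => proj G x := funext fun g => proj_smul g x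
  rw [this, Measure.map_const, measure_univ, one_smul]

theorem orbitMeasureStar_preimage_smul (h : G) (a : OrbitSpace G M) {A : Set M}
    (hA : MeasurableSet A) :
    orbitMeasureStar a ((h • ·) ⁻¹' A) = orbitMeasureStar a A := by
  obtain ⟨x, rfl⟩ := proj_surjective G a
  exact orbitMeasure_preimage_smul h x hA

variable [CompleteSpace M]

theorem coe_liftMeasure (μ : ProbabilityMeasure (OrbitSpace G M)) :
    (liftMeasure μ : Measure M) = (μ : Measure (OrbitSpace G M)).bind orbitMeasureStar := rfl

theorem liftMeasure_apply (μ : ProbabilityMeasure (OrbitSpace G M)) {A : Set M}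
    (hA : MeasurableSet A) : (liftMeasure μ : Measure M) A =
      ∫⁻ a, orbitMeasureStar a A ∂(μ : Measure (OrbitSpace G M)) := by
  rw [coe_liftMeasure, Measure.bind_apply hA measurable_orbitMeasureStar.aemeasurable]

theorem smulInvariantMeasure_liftMeasure (μ : ProbabilityMeasure (OrbitSpace G M)) :
    SMulInvariantMeasure G M (liftMeasure μ : Measure M) where
  measure_preimage_smul h A hA := by
    rw [liftMeasure_apply μ hA,
      liftMeasure_apply μ ((continuous_const_smul h).measurable hA)]
    simp only [orbitMeasureStar_preimage_smul h _ hA]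

theorem map_proj_liftMeasure (μ : ProbabilityMeasure (OrbitSpace G M)) :
    (liftMeasure μ : Measure M).map (proj G) = μ := by
  ext A hA
  rw [Measure.map_apply measurable_proj hA, liftMeasure_apply μ (measurable_proj hA)]
  simp_rw [← Measure.map_apply measurable_proj hA, map_proj_orbitMeasureStar,
    Measure.dirac_apply' _ hA]
  simp [hA]

theorem eq_liftMeasure (μ : ProbabilityMeasure (OrbitSpace G M)) (ν : ProbabilityMeasure M)
    [SMulInvariantMeasure G M (ν : Measure M)] (h : (ν : Measure M).map (proj G) = μ) :
    ν = liftMeasure μ := by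
  refine Subtype.ext (Measure.ext fun A hA => ?_)
  change (ν : Measure M) A = (liftMeasure μ : Measure M) A
  rw [liftMeasure_apply μ hA, ← h,
    lintegral_map (f := fun a => orbitMeasureStar a A)
      ((Measure.measurable_coe hA).comp measurable_orbitMeasureStar) measurable_proj,
    ← lintegral_orbitMeasure_apply (G := G) (ν : Measure M) hA]
  rfl

theorem liftMeasure_injective :
    Function.Injective (liftMeasure : ProbabilityMeasure (OrbitSpace G M) → _) := fun μ ν h => by
  refine Subtype.ext ?_
  change (μ : Measure (OrbitSpace G M)) = ν
  rw [← map_proj_liftMeasure μ, h, map_proj_liftMeasure ν]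

variable (G) in
/-- The projection of a probability measure on `M` to the orbit space. -/
def projMeasure (ν : ProbabilityMeasure M) : ProbabilityMeasure (OrbitSpace G M) :=
  ν.map measurable_proj.aemeasurable

theorem coe_projMeasure (ν : ProbabilityMeasure M) :
    (projMeasure G ν : Measure (OrbitSpace G M)) = (ν : Measure M).map (proj G) := rfl

theorem liftMeasure_projMeasure (ν : ProbabilityMeasure M)
    [SMulInvariantMeasure G M (ν : Measure M)] : liftMeasure (projMeasure G ν) = ν :=
  (eq_liftMeasure _ ν rfl).symm

theorem lintegral_liftMeasure_comp_proj (μ : ProbabilityMeasure (OrbitSpace G M))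
    {f : OrbitSpace G M → ℝ≥0∞} (hf : AEMeasurable f (μ : Measure (OrbitSpace G M))) :
    ∫⁻ x, f (proj G x) ∂(liftMeasure μ : Measure M) = ∫⁻ a, f a ∂(μ : Measure (OrbitSpace G M)) := by
  conv_rhs => rw [← map_proj_liftMeasure μ]
  rw [lintegral_map' (by rwa [map_proj_liftMeasure]) measurable_proj.aemeasurable]

theorem image_liftMeasure_eq {P : ProbabilityMeasure (OrbitSpace G M) → Prop}
    {Q : ProbabilityMeasure M → Prop} (hPQ : ∀ μ, P μ → Q (liftMeasure μ))
    (hQP : ∀ ν, Q ν → P (projMeasure G ν)) :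
    liftMeasure '' {μ : ProbabilityMeasure (OrbitSpace G M) | P μ} =
      {ν | Q ν ∧ SMulInvariantMeasure G M (ν : Measure M)} := by
  ext ν
  constructor
  · rintro ⟨μ, hμ, rfl⟩
    exact ⟨hPQ μ hμ, smulInvariantMeasure_liftMeasure μ⟩
  · rintro ⟨hν, hinv⟩
    exact ⟨projMeasure G ν, hQP ν hν, liftMeasure_projMeasure ν⟩

theorem liftMeasure_absolutelyContinuous (m : Measure M) [SFinite m] [SMulInvariantMeasure G M m]
    {μ : ProbabilityMeasure (OrbitSpace G M)}
    (hμ : (μ : Measure (OrbitSpace G M)) ≪ m.map (proj G)) :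
    (liftMeasure μ : Measure M) ≪ m := by
  refine Measure.AbsolutelyContinuous.mk fun A hA hmA => ?_
  have hmeas : Measurable fun a : OrbitSpace G M => orbitMeasureStar a A :=
    (Measure.measurable_coe hA).comp measurable_orbitMeasureStar
  rw [liftMeasure_apply μ hA, lintegral_eq_zero_iff hmeas]
  refine Filter.EventuallyEq.filter_mono ?_ hμ.ae_le
  rw [← lintegral_eq_zero_iff hmeas, lintegral_map hmeas measurable_proj]
  exact (lintegral_orbitMeasure_apply (G := G) m hA).trans hmA

end Orbit

end OrbitLift

section Moment

theorem MeasureTheory.lintegral_add_const_rpow_lt_top {X : Type*} [MeasurableSpace X] {μ : Measure X}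
    [IsFiniteMeasure μ] {p : ℝ} (hp : 1 ≤ p) {f : X → ℝ≥0∞} (hf : ∫⁻ x, f x ^ p ∂μ < ∞)
    {C : ℝ≥0∞} (hC : C < ∞) : ∫⁻ x, (f x + C) ^ p ∂μ < ∞ := by
  have hp0 : 0 ≤ p := zero_le_one.trans hp
  calc ∫⁻ x, (f x + C) ^ p ∂μ ≤ ∫⁻ x, 2 ^ (p - 1) * (f x ^ p + C ^ p) ∂μ :=
        lintegral_mono fun x => ENNReal.rpow_add_le_mul_rpow_add_rpow _ _ hp
    _ = 2 ^ (p - 1) * (∫⁻ x, f x ^ p ∂μ + C ^ p * μ univ) := by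
        rw [lintegral_const_mul' _ _ (by finiteness),
          lintegral_add_right _ measurable_const, lintegral_const]
    _ < ∞ := by finiteness

end Moment

namespace OrbitLift

open OrbitSpace

variable {G M : Type*} [Group G] [TopologicalSpace G] [IsTopologicalGroup G] [CompactSpace G]
  [MeasurableSpace G] [BorelSpace G]
  [MetricSpace M] [SecondCountableTopology M] [MeasurableSpace M] [BorelSpace M]
  [MulAction G M] [ContinuousSMul G M] [IsIsometricSMul G M] [CompleteSpace M]

theorem hasFiniteMoment_liftMeasure {p : ℝ} (hp : 1 ≤ p) {μ : ProbabilityMeasure (OrbitSpace G M)}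
    (hμ : HasFiniteMoment p (μ : Measure (OrbitSpace G M))) :
    HasFiniteMoment p (liftMeasure μ : Measure M) := by
  obtain ⟨a, ha⟩ := hμ
  obtain ⟨x₀, rfl⟩ := proj_surjective G a
  refine ⟨x₀, lt_of_le_of_lt (lintegral_mono fun x =>
    ENNReal.rpow_le_rpow (edist_le_add_diam_orbit (G := G) x x₀) (zero_le_one.trans hp)) ?_⟩
  refine MeasureTheory.lintegral_add_const_rpow_lt_top hp ?_ (ediam_orbit_lt_top x₀)
  rwa [lintegral_liftMeasure_comp_proj μ (f := fun a => edist a (proj G x₀) ^ p)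
    (by fun_prop)]

theorem hasFiniteMoment_projMeasure {p : ℝ} (hp : 0 ≤ p) {ν : ProbabilityMeasure M}
    (hν : HasFiniteMoment p (ν : Measure M)) :
    HasFiniteMoment p (projMeasure G ν : Measure (OrbitSpace G M)) := by
  obtain ⟨x₀, h⟩ := hν
  refine ⟨proj G x₀, lt_of_le_of_lt ?_ h⟩
  rw [coe_projMeasure, lintegral_map (by fun_prop) measurable_proj]
  exact lintegral_mono fun x => ENNReal.rpow_le_rpow (edist_proj_le x x₀) hp

end OrbitLift

theorem EReal.measurable_abs : Measurable EReal.abs :=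
  EReal.measurable_of_measurable_real (ENNReal.measurable_ofReal.comp (by fun_prop))

section Dual

variable {X : Type*} [MetricSpace X] [MeasurableSpace X]

theorem ERealIntegrable.ae_coe_toReal {φ : X → EReal} {μ : Measure X} (h : ERealIntegrable φ μ) :
    ∀ᵐ x ∂μ, ((φ x).toReal : EReal) = φ x := by
  have hm : AEMeasurable (fun x => (φ x).abs) μ := EReal.measurable_abs.comp_aemeasurable h.1
  filter_upwards [ae_lt_top' hm h.2.ne] with x hx
  refine EReal.coe_toReal ?_ ?_ <;> rintro h <;> simp [h] at hx

theorem ERealIntegrable.integrable_toReal {φ : X → EReal} {μ : Measure X}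
    (h : ERealIntegrable φ μ) : Integrable (fun x => (φ x).toReal) μ := by
  refine ⟨h.1.ereal_toReal.aestronglyMeasurable, lt_of_le_of_lt (lintegral_mono fun x => ?_) h.2⟩
  induction hx : φ x using EReal.rec with
  | bot => simp
  | top => simp
  | coe r =>
    beta_reduce
    rw [hx, EReal.abs_def, EReal.toReal_coe, ← ofReal_norm, Real.norm_eq_abs]

variable {π : Measure (X × X)} {μ ν : Measure X}

theorem IsCoupling.integrable_fst (h : IsCoupling π μ ν) {f : X → ℝ} (hf : Integrable f μ) :
    Integrable (fun z : X × X => f z.1) π := by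
  have := h.1
  subst this
  exact hf.comp_measurable measurable_fst

theorem IsCoupling.integrable_snd (h : IsCoupling π μ ν) {f : X → ℝ} (hf : Integrable f ν) :
    Integrable (fun z : X × X => f z.2) π := by
  have := h.2
  subst this
  exact hf.comp_measurable measurable_snd

theorem IsCoupling.ae_fst (h : IsCoupling π μ ν) {P : X → Prop} (hP : ∀ᵐ x ∂μ, P x) :
    ∀ᵐ z ∂π, P z.1 := by
  rw [← h.1] at hP
  exact ae_of_ae_map measurable_fst.aemeasurable hP

theorem IsCoupling.ae_snd (h : IsCoupling π μ ν) {P : X → Prop} (hP : ∀ᵐ x ∂ν, P x) :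
    ∀ᵐ z ∂π, P z.2 := by
  rw [← h.2] at hP
  exact ae_of_ae_map measurable_snd.aemeasurable hP

theorem IsCoupling.dualValue_eq (h : IsCoupling π μ ν) {φ ψ : X → EReal}
    (hφ : ERealIntegrable φ μ) (hψ : ERealIntegrable ψ ν) :
    dualValue μ ν φ ψ = ∫ z, ((φ z.1).toReal + (ψ z.2).toReal) ∂π := by
  have hφ' := hφ.integrable_toReal
  have hψ' := hψ.integrable_toReal
  rw [integral_add (h.integrable_fst hφ') (h.integrable_snd hψ'), dualValue]
  congr 1
  · rw [← h.1] at hφ' ⊢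
    exact integral_map measurable_fst.aemeasurable hφ'.aestronglyMeasurable
  · rw [← h.2] at hψ' ⊢
    exact integral_map measurable_snd.aemeasurable hψ'.aestronglyMeasurable

/-- An admissible pair which attains the cost almost everywhere with respect to some coupling is a
dual solution. -/
theorem IsDualAdmissible.isDualSolution {p : ℝ} (h : IsCoupling π μ ν) {φ ψ : X → EReal}
    (hadm : IsDualAdmissible p μ ν φ ψ)
    (hae : ∀ᵐ z ∂π, φ z.1 + ψ z.2 = ((dist z.1 z.2 ^ p : ℝ) : EReal)) :
    IsDualSolution p π μ ν φ ψ := by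
  refine ⟨hadm, fun φ' ψ' h' => ?_, hae⟩
  rw [h.dualValue_eq h'.left_integrable h'.right_integrable,
    h.dualValue_eq hadm.left_integrable hadm.right_integrable]
  refine integral_mono_ae
    ((h.integrable_fst h'.left_integrable.integrable_toReal).add
      (h.integrable_snd h'.right_integrable.integrable_toReal))
    ((h.integrable_fst hadm.left_integrable.integrable_toReal).add
      (h.integrable_snd hadm.right_integrable.integrable_toReal)) ?_
  filter_upwards [hae, h.ae_fst h'.left_integrable.ae_coe_toReal,
    h.ae_snd h'.right_integrable.ae_coe_toReal, h.ae_fst hadm.left_integrable.ae_coe_toReal,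
    h.ae_snd hadm.right_integrable.ae_coe_toReal] with z hz h1 h2 h3 h4
  have hle := (h'.add_le z.1 z.2).trans_eq hz.symm
  rw [← h1, ← h2, ← h3, ← h4] at hle
  exact_mod_cast hle

end Dual

namespace OrbitLift

open OrbitSpace

section Plan

variable {G M : Type*} [Group G] [TopologicalSpace G] [IsTopologicalGroup G] [CompactSpace G]
  [MeasurableSpace G] [BorelSpace G]
  [MetricSpace M] [SecondCountableTopology M] [MeasurableSpace M] [BorelSpace M]
  [MulAction G M] [ContinuousSMul G M]

theorem measurable_orbitPlanMap (x y : M) : Measurable fun g : G => (g • x, g • y) :=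
  (measurable_orbitMap x).prodMk (measurable_orbitMap y)

theorem map_fst_orbitPlan (x y : M) : (orbitPlan G x y).map Prod.fst = orbitMeasure G x :=
  Measure.map_map measurable_fst (measurable_orbitPlanMap x y)

theorem map_snd_orbitPlan (x y : M) : (orbitPlan G x y).map Prod.snd = orbitMeasure G y :=
  Measure.map_map measurable_snd (measurable_orbitPlanMap x y)

variable [IsIsometricSMul G M] {s : OrbitSpace G M × OrbitSpace G M → M × M}

theorem measurable_liftPlanMap (hs : Measurable s) :
    Measurable fun q : (OrbitSpace G M × OrbitSpace G M) × G =>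
      (q.2 • (s q.1).1, q.2 • (s q.1).2) := by
  have hact : Measurable fun q : M × G => q.2 • q.1 :=
    (continuous_snd.smul continuous_fst).measurable
  exact (hact.comp (f := fun q : (OrbitSpace G M × OrbitSpace G M) × G => ((s q.1).1, q.2))
    (by fun_prop)).prodMk
    (hact.comp (f := fun q : (OrbitSpace G M × OrbitSpace G M) × G => ((s q.1).2, q.2))
    (by fun_prop))

theorem orbitPlan_apply (z : OrbitSpace G M × OrbitSpace G M) {A : Set (M × M)}
    (hA : MeasurableSet A) :
    orbitPlan G (s z).1 (s z).2 A =
      haarProb G (Prod.mk z ⁻¹' ((fun q : (OrbitSpace G M × OrbitSpace G M) × G =>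
        (q.2 • (s q.1).1, q.2 • (s q.1).2)) ⁻¹' A)) :=
  Measure.map_apply (measurable_orbitPlanMap _ _) hA

theorem measurable_orbitPlan_section (hs : Measurable s) :
    Measurable fun z => orbitPlan G (s z).1 (s z).2 := by
  refine Measure.measurable_of_measurable_coe _ fun A hA => ?_
  simp_rw [orbitPlan_apply _ hA]
  exact measurable_measure_prodMk_left (measurable_liftPlanMap hs hA)

theorem liftPlan_apply (hs : Measurable s) (π : Measure (OrbitSpace G M × OrbitSpace G M))
    {A : Set (M × M)} (hA : MeasurableSet A) :
    liftPlan s π A = ∫⁻ z, orbitPlan G (s z).1 (s z).2 A ∂π :=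
  Measure.bind_apply hA (measurable_orbitPlan_section hs).aemeasurable

theorem liftPlan_eq_map_prod (hs : Measurable s) (π : Measure (OrbitSpace G M × OrbitSpace G M)) :
    liftPlan s π = (π.prod (haarProb G)).map fun q => (q.2 • (s q.1).1, q.2 • (s q.1).2) := by
  ext A hA
  rw [liftPlan_apply hs π hA, Measure.map_apply (measurable_liftPlanMap hs) hA,
    Measure.prod_apply (measurable_liftPlanMap hs hA)]
  exact lintegral_congr fun z => orbitPlan_apply z hA

variable (G M) in
/-- The projection `M × M → M* × M*`. -/
def projPair : M × M → OrbitSpace G M × OrbitSpace G M := Prod.map (proj G) (proj G)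

theorem measurable_projPair : Measurable (projPair G M) :=
  measurable_proj.prodMap measurable_proj

theorem map_projPair_liftPlan (hs : IsOptimalSection s)
    (π : Measure (OrbitSpace G M × OrbitSpace G M)) [SFinite π] :
    (liftPlan s π).map (projPair G M) = π := by
  rw [liftPlan_eq_map_prod hs.measurable,
    Measure.map_map measurable_projPair (measurable_liftPlanMap hs.measurable)]
  have : (projPair G M ∘ fun q : (OrbitSpace G M × OrbitSpace G M) × G =>
      (q.2 • (s q.1).1, q.2 • (s q.1).2)) = Prod.fst := by
    ext q : 1
    exact Prod.ext ((proj_smul _ _).trans (hs.proj_fst q.1)) ((proj_smul _ _).trans (hs.proj_snd q.1))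
  rw [this, Measure.map_fst_prod, measure_univ, one_smul]

theorem ae_dist_eq_liftPlan (hs : IsOptimalSection s)
    (π : Measure (OrbitSpace G M × OrbitSpace G M)) :
    ∀ᵐ z ∂(liftPlan s π), dist z.1 z.2 = dist (proj G z.1) (proj G z.2) := by
  have hc : Continuous (proj G : M → OrbitSpace G M) := lipschitzWith_proj.continuous
  have hK : IsClosed {w : M × M | dist w.1 w.2 = dist (proj G w.1) (proj G w.2)} :=
    isClosed_eq (by fun_prop) (by fun_prop)
  rw [liftPlan_eq_map_prod hs.measurable,
    ae_map_iff (measurable_liftPlanMap hs.measurable).aemeasurable hK.measurableSet]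
  refine Filter.Eventually.of_forall fun q => ?_
  simp only [dist_smul, proj_smul]
  rw [hs.dist_eq, hs.proj_fst, hs.proj_snd]

theorem transportCost_liftPlan (p : ℝ) (hs : IsOptimalSection s)
    (π : Measure (OrbitSpace G M × OrbitSpace G M)) [SFinite π] :
    transportCost p (liftPlan s π) = transportCost p π := by
  conv_rhs => rw [← map_projPair_liftPlan hs π]
  rw [transportCost, transportCost, lintegral_map (by fun_prop) measurable_projPair]
  refine lintegral_congr_ae ?_
  filter_upwards [ae_dist_eq_liftPlan hs π] with z hz
  simp only [projPair, Prod.map, edist_dist, hz]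

theorem transportCost_map_projPair_le {p : ℝ} (hp : 0 ≤ p) (π : Measure (M × M)) :
    transportCost p (π.map (projPair G M)) ≤ transportCost p π := by
  rw [transportCost, lintegral_map (by fun_prop) measurable_projPair]
  exact lintegral_mono fun z => ENNReal.rpow_le_rpow (edist_proj_le z.1 z.2) hp

variable [CompleteSpace M]

theorem isCoupling_map_projPair {π : Measure (M × M)} {μ₀ μ₁ : ProbabilityMeasure (OrbitSpace G M)}
    (h : IsCoupling π (liftMeasure μ₀ : Measure M) (liftMeasure μ₁)) :
    IsCoupling (π.map (projPair G M)) (μ₀ : Measure (OrbitSpace G M)) μ₁ := by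
  constructor
  · rw [← map_proj_liftMeasure μ₀, ← h.1, Measure.map_map measurable_fst measurable_projPair,
      Measure.map_map measurable_proj measurable_fst]
    rfl
  · rw [← map_proj_liftMeasure μ₁, ← h.2, Measure.map_map measurable_snd measurable_projPair,
      Measure.map_map measurable_proj measurable_snd]
    rfl

theorem isCoupling_liftPlan (hs : IsOptimalSection s)
    {π : Measure (OrbitSpace G M × OrbitSpace G M)} {μ₀ μ₁ : ProbabilityMeasure (OrbitSpace G M)}
    (h : IsCoupling π (μ₀ : Measure (OrbitSpace G M)) μ₁) :
    IsCoupling (liftPlan s π) (liftMeasure μ₀ : Measure M) (liftMeasure μ₁) := by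
  have hmeas : ∀ {A : Set M}, MeasurableSet A →
      Measurable fun a : OrbitSpace G M => orbitMeasureStar a A := fun hA =>
    (Measure.measurable_coe hA).comp measurable_orbitMeasureStar
  constructor
  · ext A hA
    rw [Measure.map_apply measurable_fst hA, liftPlan_apply hs.measurable π (measurable_fst hA),
      liftMeasure_apply μ₀ hA, ← h.1, lintegral_map (hmeas hA) measurable_fst]
    refine lintegral_congr fun z => ?_
    rw [← Measure.map_apply measurable_fst hA, map_fst_orbitPlan, ← orbitMeasureStar_proj,
      hs.proj_fst]
  · ext A hA
    rw [Measure.map_apply measurable_snd hA, liftPlan_apply hs.measurable π (measurable_snd hA),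
      liftMeasure_apply μ₁ hA, ← h.2, lintegral_map (hmeas hA) measurable_snd]
    refine lintegral_congr fun z => ?_
    rw [← Measure.map_apply measurable_snd hA, map_snd_orbitPlan, ← orbitMeasureStar_proj,
      hs.proj_snd]

end Plan

theorem _root_.IsCoupling.isProbabilityMeasure {X : Type*} [MeasurableSpace X]
    {π : Measure (X × X)} {μ ν : Measure X} [IsProbabilityMeasure μ] (h : IsCoupling π μ ν) :
    IsProbabilityMeasure π :=
  ⟨by rw [← measure_univ (μ := μ), ← h.1, Measure.map_apply measurable_fst MeasurableSet.univ,
    preimage_univ]⟩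

section Wasserstein

variable {G M : Type*} [Group G] [TopologicalSpace G] [IsTopologicalGroup G] [CompactSpace G]
  [MeasurableSpace G] [BorelSpace G]
  [MetricSpace M] [SecondCountableTopology M] [MeasurableSpace M] [BorelSpace M]
  [MulAction G M] [ContinuousSMul G M] [IsIsometricSMul G M] [CompleteSpace M]
  {p : ℝ} {μ₀ μ₁ : ProbabilityMeasure (OrbitSpace G M)}

theorem wassersteinDist_liftMeasure (hp : 0 ≤ p) (μ₀ μ₁ : ProbabilityMeasure (OrbitSpace G M)) :
    wassersteinDist p (liftMeasure μ₀ : Measure M) (liftMeasure μ₁) =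
      wassersteinDist p (μ₀ : Measure (OrbitSpace G M)) μ₁ := by
  obtain ⟨s, hs⟩ := exists_isOptimalSection (G := G) (M := M)
  unfold wassersteinDist
  congr 1
  refine le_antisymm (le_iInf₂ fun π hπ => ?_) (le_iInf₂ fun π hπ => ?_)
  · have := hπ.isProbabilityMeasure
    exact iInf₂_le_of_le _ (isCoupling_liftPlan hs hπ) (transportCost_liftPlan p hs π).le
  · exact iInf₂_le_of_le _ (isCoupling_map_projPair hπ) (transportCost_map_projPair_le hp π)

theorem isWassersteinGeodesic_liftMeasure (hp : 1 ≤ p)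
    {γ : unitInterval → ProbabilityMeasure (OrbitSpace G M)} (hγ : IsWassersteinGeodesic p γ) :
    IsWassersteinGeodesic p fun t => liftMeasure (γ t) :=
  ⟨fun t => hasFiniteMoment_liftMeasure hp (hγ.1 t), fun s t => by
    simp only [wassersteinDist_liftMeasure (zero_le_one.trans hp), hγ.2 s t]⟩

variable {s : OrbitSpace G M × OrbitSpace G M → M × M}
  {π : Measure (OrbitSpace G M × OrbitSpace G M)}

theorem isOptimalCoupling_liftPlan (hp : 0 ≤ p) (hs : IsOptimalSection s)
    (h : IsOptimalCoupling p π (μ₀ : Measure (OrbitSpace G M)) μ₁) :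
    IsOptimalCoupling p (liftPlan s π) (liftMeasure μ₀ : Measure M) (liftMeasure μ₁) := by
  have := h.1.isProbabilityMeasure
  refine ⟨isCoupling_liftPlan hs h.1, fun π' hπ' => ?_⟩
  rw [transportCost_liftPlan p hs π]
  exact (h.2 _ (isCoupling_map_projPair hπ')).trans (transportCost_map_projPair_le hp π')

theorem erealIntegrable_liftFun {μ : ProbabilityMeasure (OrbitSpace G M)}
    {φ : OrbitSpace G M → EReal} (h : ERealIntegrable φ (μ : Measure (OrbitSpace G M))) :
    ERealIntegrable (liftFun φ) (liftMeasure μ : Measure M) := by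
  refine ⟨AEMeasurable.comp_measurable (by rw [map_proj_liftMeasure]; exact h.1) measurable_proj, ?_⟩
  refine lt_of_eq_of_lt ?_ h.2
  exact lintegral_liftMeasure_comp_proj μ (f := fun a => (φ a).abs)
    (EReal.measurable_abs.comp_aemeasurable h.1)

theorem isDualAdmissible_liftFun (hp : 0 ≤ p) {φ ψ : OrbitSpace G M → EReal}
    (h : IsDualAdmissible p (μ₀ : Measure (OrbitSpace G M)) μ₁ φ ψ) :
    IsDualAdmissible p (liftMeasure μ₀ : Measure M) (liftMeasure μ₁) (liftFun φ) (liftFun ψ) where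
  left_ne_top _ := h.left_ne_top _
  right_ne_top _ := h.right_ne_top _
  left_integrable := erealIntegrable_liftFun h.left_integrable
  right_integrable := erealIntegrable_liftFun h.right_integrable
  add_le x y := (h.add_le _ _).trans <| EReal.coe_le_coe_iff.2 <|
    Real.rpow_le_rpow dist_nonneg (dist_proj_le x y) hp

theorem isDualSolution_liftFun (hp : 0 ≤ p) (hs : IsOptimalSection s)
    (hπ : IsCoupling π (μ₀ : Measure (OrbitSpace G M)) μ₁) {φ ψ : OrbitSpace G M → EReal}
    (h : IsDualSolution p π (μ₀ : Measure (OrbitSpace G M)) μ₁ φ ψ) :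
    IsDualSolution p (liftPlan s π) (liftMeasure μ₀ : Measure M) (liftMeasure μ₁)
      (liftFun φ) (liftFun ψ) := by
  have := hπ.isProbabilityMeasure
  refine (isDualAdmissible_liftFun hp h.admissible).isDualSolution (isCoupling_liftPlan hs hπ) ?_
  have hae := h.ae_eq
  rw [← map_projPair_liftPlan hs π] at hae
  filter_upwards [ae_of_ae_map measurable_projPair.aemeasurable hae,
    ae_dist_eq_liftPlan hs π] with z hz hd
  rw [hd]
  exact hz

end Wasserstein

section Concave

variable {G M : Type*} [Group G] [TopologicalSpace G] [CompactSpace G]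
  [MetricSpace M] [MulAction G M] [ContinuousSMul G M] [IsIsometricSMul G M] {p : ℝ}

theorem cTransform_liftFun (hp : 0 ≤ p) (φ : OrbitSpace G M → EReal) :
    cTransform p (liftFun φ : M → EReal) = liftFun (cTransform p φ) := by
  ext x
  refine le_antisymm (le_iInf fun b => ?_) (le_iInf fun y => ?_)
  · obtain ⟨y, rfl⟩ := proj_surjective G b
    obtain ⟨g, hg⟩ := exists_dist_proj_eq (G := G) y x
    refine (iInf_le _ (g • y)).trans_eq ?_
    rw [dist_comm, hg, dist_comm, liftFun, proj_smul]
  · refine (iInf_le _ (proj G y)).trans (EReal.sub_le_sub (EReal.coe_le_coe_iff.2 ?_) le_rfl)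
    exact Real.rpow_le_rpow dist_nonneg (dist_proj_le x y) hp

theorem isCConcave_liftFun (hp : 0 ≤ p) {φ : OrbitSpace G M → EReal} (h : IsCConcave p φ) :
    IsCConcave p (liftFun φ : M → EReal) := by
  obtain ⟨hφ, ψ, hψ, rfl⟩ := h
  exact ⟨fun _ => hφ _, liftFun ψ, fun _ => hψ _, (cTransform_liftFun hp ψ).symm⟩

end Concave

end OrbitLift

end

open OrbitSpace OrbitLift in
theorem theorem3p2
    {M : Type*} [MetricSpace M] [CompleteSpace M] [SecondCountableTopology M]
    [MeasurableSpace M] [BorelSpace M]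
    {G : Type*} [Group G] [TopologicalSpace G] [IsTopologicalGroup G] [CompactSpace G]
    [MeasurableSpace G] [BorelSpace G]
    [MulAction G M] [ContinuousSMul G M] [IsIsometricSMul G M]
    (m : Measure M) [SigmaFinite m] [SMulInvariantMeasure G M m]
    (p : ℝ) (hp : 1 ≤ p) :
    -- the lift is the unique invariant probability measure projecting to `μ`
    (∀ μ : ProbabilityMeasure (OrbitSpace G M),
      SMulInvariantMeasure G M (liftMeasure μ : Measure M) ∧
      (liftMeasure μ : Measure M).map (proj G) = μ ∧
      ∀ ν : ProbabilityMeasure M, SMulInvariantMeasure G M (ν : Measure M) →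
        (ν : Measure M).map (proj G) = μ → ν = liftMeasure μ) ∧
    -- absolutely continuous measures
    (liftMeasure '' {μ : ProbabilityMeasure (OrbitSpace G M) |
        (μ : Measure (OrbitSpace G M)) ≪ m.map (proj G)} =
      {ν : ProbabilityMeasure M |
        (ν : Measure M) ≪ m ∧ SMulInvariantMeasure G M (ν : Measure M)}) ∧
    -- measures with finite `p`-th moment
    (liftMeasure '' {μ : ProbabilityMeasure (OrbitSpace G M) |
        HasFiniteMoment p (μ : Measure (OrbitSpace G M))} =
      {ν : ProbabilityMeasure M |
        HasFiniteMoment p (ν : Measure M) ∧ SMulInvariantMeasure G M (ν : Measure M)}) ∧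
    -- isometric embedding
    Function.Injective (liftMeasure : ProbabilityMeasure (OrbitSpace G M) → _) ∧
    (∀ μ₀ μ₁ : ProbabilityMeasure (OrbitSpace G M),
      HasFiniteMoment p (μ₀ : Measure (OrbitSpace G M)) →
      HasFiniteMoment p (μ₁ : Measure (OrbitSpace G M)) →
      wassersteinDist p (liftMeasure μ₀ : Measure M) (liftMeasure μ₁) =
        wassersteinDist p (μ₀ : Measure (OrbitSpace G M)) μ₁) ∧
    -- geodesics lift to invariant geodesics
    (∀ γ : unitInterval → ProbabilityMeasure (OrbitSpace G M),
      IsWassersteinGeodesic p γ →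
      IsWassersteinGeodesic p (fun t => liftMeasure (γ t)) ∧
      ∀ t, SMulInvariantMeasure G M (liftMeasure (γ t) : Measure M)) ∧
    -- optimal plans and dual solutions
    (∃ s : OrbitSpace G M × OrbitSpace G M → M × M, IsOptimalSection s) ∧
    (∀ s : OrbitSpace G M × OrbitSpace G M → M × M, IsOptimalSection s →
      ∀ μ₀ μ₁ : ProbabilityMeasure (OrbitSpace G M),
      HasFiniteMoment p (μ₀ : Measure (OrbitSpace G M)) →
      HasFiniteMoment p (μ₁ : Measure (OrbitSpace G M)) →
      ∀ π : Measure (OrbitSpace G M × OrbitSpace G M),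
      IsOptimalCoupling p π (μ₀ : Measure (OrbitSpace G M)) μ₁ →
      IsOptimalCoupling p (liftPlan s π) (liftMeasure μ₀ : Measure M) (liftMeasure μ₁) ∧
      (∀ᵐ z ∂(liftPlan s π), dist z.1 z.2 = dist (proj G z.1) (proj G z.2)) ∧
      ∀ φ ψ : OrbitSpace G M → EReal,
        IsDualSolution p π (μ₀ : Measure (OrbitSpace G M)) μ₁ φ ψ →
        IsDualSolution p (liftPlan s π) (liftMeasure μ₀ : Measure M) (liftMeasure μ₁)
          (liftFun φ) (liftFun ψ)) ∧
    -- `c_p`-concave functions, and their `c_p`-transforms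
    (∀ φ : OrbitSpace G M → EReal, IsCConcave p φ →
      IsCConcave p (liftFun φ : M → EReal) ∧
      cTransform p (liftFun φ : M → EReal) = liftFun (cTransform p φ)) := by
  have hp0 : 0 ≤ p := zero_le_one.trans hp
  refine ⟨fun μ => ⟨smulInvariantMeasure_liftMeasure μ, map_proj_liftMeasure μ,
      fun ν _ hν => eq_liftMeasure μ ν hν⟩,
    image_liftMeasure_eq (fun μ hμ => liftMeasure_absolutelyContinuous m hμ)
      (fun ν hν => hν.map measurable_proj),
    image_liftMeasure_eq (fun μ hμ => hasFiniteMoment_liftMeasure hp hμ)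
      (fun ν hν => hasFiniteMoment_projMeasure hp0 hν),
    liftMeasure_injective, fun μ₀ μ₁ _ _ => wassersteinDist_liftMeasure hp0 μ₀ μ₁,
    fun γ hγ => ⟨isWassersteinGeodesic_liftMeasure hp hγ,
      fun t => smulInvariantMeasure_liftMeasure (γ t)⟩,
    exists_isOptimalSection, fun s hs μ₀ μ₁ _ _ π hπ => ⟨isOptimalCoupling_liftPlan hp0 hs hπ,
      ae_dist_eq_liftPlan hs π, fun φ ψ h => isDualSolution_liftFun hp0 hs hπ.1 h⟩,
    fun φ hφ => ⟨isCConcave_liftFun hp0 hφ, cTransform_liftFun hp0 φ⟩⟩
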